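/- Let $\mathbb{D}\subset\mathbb{C}$ be the open unit disc with the Poincaré distance $\rho(a,b)=\tfrac12\log\frac{1+t}{1-t}$, $t=\left|\frac{a-b}{1-\bar a b}\right|$. For a domain (non-empty connected open set) $\Omega\subset\mathbb{C}^d$ and $z,w\in\Omega$ let the Kobayashi pseudodistance $\mathsf{k}_\Omega(z,w)$ be the infimum of $\sum_{j=0}^{m-1}\rho(a_j,b_j)$ over all finite chains of holomorphic maps $f_j:\mathbb{D}\to\Omega$ and points $a_j,b_j\in\mathbb{D}$ $(0\le j<m)$ that join $z$ to $w$, i.e. $f_0(a_0)=z$, $f_j(b_j)=f_{j+1}(a_{j+1})$ for $0\le j<m-1$, and $f_{m-1}(b_{m-1})=w$. The domain $\Omega$ is called Kobayashi hyperbolic if $\mathsf{k}_\Omega(z,w)=0$ implies $z=w$ for all $z,w\in\Omega$. For $x\in\partial\Omega$ (the topological boundary of $\Omega$ in $\mathbb{C}^d$), $o\in\Omega$ and $R>0$, the big horosphere with center $x$, pole $o$ and radius $R$ is \[ H^b_o(x,R)=\Big\{z\in\Omega:\ \liminf_{w\to x,\,w\in\Omega}\big(\mathsf{k}_\Omega(z,w)-\mathsf{k}_\Omega(o,w)\big)<\tfrac12\log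 R\Big\}. \] **Proposition.** Let $\Omega\subset\mathbb{C}^d$ be a Kobayashi hyperbolic convex domain and let $x\in\partial\Omega$. Then for every $R>0$ and every $o\in\Omega$, \[ x\in\overline{H^b_o(x,R)}, \] where the closure is taken in $\mathbb{C}^d$. -/

import Mathlib

open Filter Topology Metric Set

noncomputable section

namespace Kobayashi

/-- The Poincaré distance of the open unit disc of `ℂ`,
`artanh t = (1/2) log ((1 + t) / (1 - t))` with `t = |(a - b) / (1 - conj a * b)|`
(the normalization of curvature `-4`). -/
def poincareDist (a b : ℂ) : ℝ :=
  Real.artanh ‖(a - b) / (1 - (starRingEnd ℂ) a * b)‖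

variable {d : ℕ}

/-- `f` restricts to a holomorphic map from the open unit disc into `Ω`. -/
def IsAnalyticDisc (Ω : Set (EuclideanSpace ℂ (Fin d))) (f : ℂ → EuclideanSpace ℂ (Fin d)) :
    Prop :=
  DifferentiableOn ℂ f (ball 0 1) ∧ MapsTo f (ball 0 1) Ω

/-- The lengths of the chains of analytic discs of `Ω` from `z` to `w`: a chain consists of points
`z = p 0, p 1, …, p m = w`, discs `f j` and parameters `a j, b j` with `f j (a j) = p j` and
`f j (b j) = p (j + 1)` for `j < m`; its length is the sum of the Poincaré distances of `a j`
and `b j`. -/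
def chainLengths (Ω : Set (EuclideanSpace ℂ (Fin d))) (z w : EuclideanSpace ℂ (Fin d)) : Set ℝ :=
  {L | ∃ (m : ℕ) (p : ℕ → EuclideanSpace ℂ (Fin d)) (f : ℕ → ℂ → EuclideanSpace ℂ (Fin d))
      (a b : ℕ → ℂ),
      p 0 = z ∧ p m = w ∧
      (∀ j < m, IsAnalyticDisc Ω (f j) ∧ a j ∈ ball (0 : ℂ) 1 ∧ b j ∈ ball (0 : ℂ) 1 ∧
        f j (a j) = p j ∧ f j (b j) = p (j + 1)) ∧
      L = ∑ j ∈ Finset.range m, poincareDist (a j) (b j)}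

/-- The Kobayashi (pseudo)distance of `Ω`. For `Ω` open and connected and `z, w ∈ Ω` the set of
lengths is nonempty and bounded below by `0`, so that this is a true infimum. -/
def kobayashiDist (Ω : Set (EuclideanSpace ℂ (Fin d))) (z w : EuclideanSpace ℂ (Fin d)) : ℝ :=
  sInf (chainLengths Ω z w)

/-- `Ω` is Kobayashi hyperbolic: the Kobayashi pseudodistance separates the points of `Ω`. -/
def IsHyperbolic (Ω : Set (EuclideanSpace ℂ (Fin d))) : Prop :=
  ∀ z ∈ Ω, ∀ w ∈ Ω, kobayashiDist Ω z w = 0 → z = w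

/-- The big horosphere of `Ω` with center `x`, pole `o` and radius `R`. The lower limit is over
`w → x` with `w ∈ Ω` and is taken in the extended reals. -/
def bigHorosphere (Ω : Set (EuclideanSpace ℂ (Fin d))) (o x : EuclideanSpace ℂ (Fin d)) (R : ℝ) :
    Set (EuclideanSpace ℂ (Fin d)) :=
  {z | z ∈ Ω ∧
    liminf (fun w => ((kobayashiDist Ω z w - kobayashiDist Ω o w : ℝ) : EReal)) (𝓝[Ω] x) <
      (((1 / 2) * Real.log R : ℝ) : EReal)}

end Kobayashi

end

/-!
Let `T t` be the homothety with center `x` and ratio `t ∈ (0, 1)`, and let `k` be the Kobayashi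
distance of `Ω`. Being a holomorphic self-map of `Ω`, `T t` does not increase `k`, so
`k (T t o) (T (t ^ (n + 1)) o) ≤ k o (T (t ^ n) o)`. On the other hand a supporting half-space of
`Ω` at `x` and Harnack's inequality give `n * (-1/2 * log t) ≤ k o (T (t ^ n) o)`. A sequence
growing that fast must infinitely often increase by almost `-1/2 * log t` in one step, which along
`w = T (t ^ (n + 1)) o → x` bounds the lower limit of `k (T t o) w - k o w` by `1/2 * log t`. So
`T t o` lies in the horosphere of radius `R` as soon as `t < R`, and `T t o → x` as `t → 0`.
-/

namespace Kobayashi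

open ComplexConjugate AffineMap

/-- The Möbius transformation of the unit disc that sends `a` to `0`; its inverse is
`moebius (-a)`. It is meant for `‖a‖ < 1` and `‖z‖ < 1`, where the denominator does not vanish. -/
noncomputable def moebius (a z : ℂ) : ℂ :=
  (z - a) / (1 - conj a * z)

theorem norm_one_sub_conj_mul_sq (a z : ℂ) :
    ‖1 - conj a * z‖ ^ 2 = ‖z - a‖ ^ 2 + (1 - ‖a‖ ^ 2) * (1 - ‖z‖ ^ 2) := by
  simp only [← Complex.normSq_eq_norm_sq, Complex.normSq_apply, Complex.sub_re, Complex.sub_im,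
    Complex.mul_re, Complex.mul_im, Complex.conj_re, Complex.conj_im, Complex.one_re,
    Complex.one_im]
  ring

theorem norm_sub_lt_norm_one_sub_conj_mul {a z : ℂ} (ha : ‖a‖ < 1) (hz : ‖z‖ < 1) :
    ‖z - a‖ < ‖1 - conj a * z‖ := by
  have ha' : 0 < 1 - ‖a‖ ^ 2 := sub_pos.2 (pow_lt_one₀ (norm_nonneg a) ha two_ne_zero)
  have hz' : 0 < 1 - ‖z‖ ^ 2 := sub_pos.2 (pow_lt_one₀ (norm_nonneg z) hz two_ne_zero)
  refine lt_of_pow_lt_pow_left₀ 2 (norm_nonneg _) ?_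
  rw [norm_one_sub_conj_mul_sq]
  exact lt_add_of_pos_right _ (mul_pos ha' hz')

theorem one_sub_conj_mul_ne_zero {a z : ℂ} (ha : ‖a‖ < 1) (hz : ‖z‖ < 1) :
    1 - conj a * z ≠ 0 :=
  norm_pos_iff.1 ((norm_nonneg _).trans_lt (norm_sub_lt_norm_one_sub_conj_mul ha hz))

theorem norm_moebius_lt_one {a z : ℂ} (ha : ‖a‖ < 1) (hz : ‖z‖ < 1) : ‖moebius a z‖ < 1 := by
  rw [moebius, norm_div, div_lt_one (norm_pos_iff.2 (one_sub_conj_mul_ne_zero ha hz))]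
  exact norm_sub_lt_norm_one_sub_conj_mul ha hz

theorem differentiableOn_moebius {a : ℂ} (ha : ‖a‖ < 1) :
    DifferentiableOn ℂ (moebius a) (ball 0 1) :=
  (differentiableOn_id.sub_const a).div (by fun_prop)
    fun _ hz => one_sub_conj_mul_ne_zero ha (mem_ball_zero_iff.1 hz)

theorem moebius_neg_zero (a : ℂ) : moebius (-a) 0 = a := by
  simp [moebius]

theorem moebius_neg_moebius {a z : ℂ} (ha : ‖a‖ < 1) (hz : ‖z‖ < 1) :
    moebius (-a) (moebius a z) = z := by
  have hmul : moebius a z * (1 - conj a * z) = z - a :=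
    div_mul_cancel₀ _ (one_sub_conj_mul_ne_zero ha hz)
  have hne := one_sub_conj_mul_ne_zero (norm_neg a ▸ ha) (norm_moebius_lt_one ha hz)
  rw [moebius, div_eq_iff hne, map_neg]
  linear_combination hmul

theorem poincareDist_eq_artanh_norm_moebius (a b : ℂ) :
    poincareDist a b = Real.artanh ‖moebius a b‖ := by
  rw [poincareDist, moebius, norm_div, norm_div, norm_sub_rev]

theorem poincareDist_nonneg (a b : ℂ) : 0 ≤ poincareDist a b :=
  Real.artanh_nonneg (norm_nonneg _)

theorem norm_add_conj_sq (p q : ℂ) : ‖p + conj q‖ ^ 2 = ‖p - q‖ ^ 2 + 4 * p.re * q.re := by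
  simp only [← Complex.normSq_eq_norm_sq, Complex.normSq_apply, Complex.add_re, Complex.add_im,
    Complex.sub_re, Complex.sub_im, Complex.conj_re, Complex.conj_im]
  ring

/-- The Schwarz lemma for maps from the disc to the right half-plane, which the Cayley transform
`p ↦ (p - q) / (p + conj q)` maps to the disc, sending `q` to `0`. -/
theorem norm_sub_le_norm_mul_norm_add_conj {F : ℂ → ℂ} (hF : DifferentiableOn ℂ F (ball 0 1))
    (hpos : ∀ z ∈ ball (0 : ℂ) 1, 0 < (F z).re) {z : ℂ} (hz : ‖z‖ < 1) :
    ‖F z - F 0‖ ≤ ‖z‖ * ‖F z + conj (F 0)‖ := by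
  have h0 : 0 < (F 0).re := hpos 0 (mem_ball_self one_pos)
  have hlt : ∀ w ∈ ball (0 : ℂ) 1, ‖F w - F 0‖ < ‖F w + conj (F 0)‖ := fun w hw => by
    have hw0 := hpos w hw
    refine lt_of_pow_lt_pow_left₀ 2 (norm_nonneg _) ?_
    rw [norm_add_conj_sq]
    exact lt_add_of_pos_right _ (by positivity)
  have hden : ∀ w ∈ ball (0 : ℂ) 1, 0 < ‖F w + conj (F 0)‖ := fun w hw =>
    (norm_nonneg _).trans_lt (hlt w hw)
  have hschwarz : ‖(F z - F 0) / (F z + conj (F 0))‖ ≤ ‖z‖ := by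
    refine Complex.norm_le_norm_of_mapsTo_ball
      (f := fun w => (F w - F 0) / (F w + conj (F 0))) (R := 1)
      ((hF.sub_const _).div (hF.add_const _) fun w hw => norm_pos_iff.1 (hden w hw))
      (fun w hw => ?_) (by simp) hz
    rw [mem_closedBall_zero_iff, norm_div, div_le_one (hden w hw)]
    exact (hlt w hw).le
  rwa [norm_div, div_le_iff₀ (hden z (mem_ball_zero_iff.2 hz))] at hschwarz

theorem re_zero_mul_one_sub_norm_le {F : ℂ → ℂ} (hF : DifferentiableOn ℂ F (ball 0 1))
    (hpos : ∀ z ∈ ball (0 : ℂ) 1, 0 < (F z).re) {z : ℂ} (hz : ‖z‖ < 1) :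
    (F 0).re * (1 - ‖z‖) ≤ (F z).re * (1 + ‖z‖) := by
  have h0 : 0 < (F 0).re := hpos 0 (mem_ball_self one_pos)
  have h1 : 0 < (F z).re := hpos z (mem_ball_zero_iff.2 hz)
  have hz2 : ‖z‖ ^ 2 ≤ 1 := pow_le_one₀ (norm_nonneg z) hz.le
  have hschwarz : ‖F z - F 0‖ ^ 2 ≤ ‖z‖ ^ 2 * (‖F z - F 0‖ ^ 2 + 4 * (F z).re * (F 0).re) := by
    rw [← norm_add_conj_sq, ← mul_pow]
    exact pow_le_pow_left₀ (norm_nonneg _) (norm_sub_le_norm_mul_norm_add_conj hF hpos hz) 2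
  have hre : ((F z).re - (F 0).re) ^ 2 ≤ ‖F z - F 0‖ ^ 2 := by
    rw [← Complex.sub_re, ← sq_abs]
    exact pow_le_pow_left₀ (abs_nonneg _) (Complex.abs_re_le_norm _) 2
  have hsq : ((F 0).re - (F z).re) ^ 2 ≤ (‖z‖ * ((F z).re + (F 0).re)) ^ 2 := by
    linear_combination hschwarz + (1 - ‖z‖ ^ 2) * hre
  linarith [(abs_le_of_sq_le_sq' hsq (by positivity)).2]

/-- Harnack's inequality, moved from the center of the disc to `a` by a Möbius transformation. -/
theorem half_log_re_sub_le_poincareDist {F : ℂ → ℂ} (hF : DifferentiableOn ℂ F (ball 0 1))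
    (hpos : ∀ z ∈ ball (0 : ℂ) 1, 0 < (F z).re) {a b : ℂ} (ha : a ∈ ball (0 : ℂ) 1)
    (hb : b ∈ ball (0 : ℂ) 1) :
    1 / 2 * (Real.log (F a).re - Real.log (F b).re) ≤ poincareDist a b := by
  have ha' := mem_ball_zero_iff.1 ha
  have hb' := mem_ball_zero_iff.1 hb
  have hna : ‖-a‖ < 1 := norm_neg a ▸ ha'
  have hlt : ‖moebius a b‖ < 1 := norm_moebius_lt_one ha' hb'
  have hmaps : MapsTo (moebius (-a)) (ball 0 1) (ball 0 1) := fun z hz =>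
    mem_ball_zero_iff.2 (norm_moebius_lt_one hna (mem_ball_zero_iff.1 hz))
  have hcenter := re_zero_mul_one_sub_norm_le (hF.comp (differentiableOn_moebius hna) hmaps)
    (fun z hz => hpos _ (hmaps hz)) hlt
  simp only [Function.comp_apply, moebius_neg_zero, moebius_neg_moebius ha' hb'] at hcenter
  have hpa := hpos a ha
  have hpb := hpos b hb
  have hnn := norm_nonneg (moebius a b)
  rw [poincareDist_eq_artanh_norm_moebius, Real.artanh_eq_half_log ⟨by linarith, hlt.le⟩,
    ← Real.log_div hpa.ne' hpb.ne']
  refine mul_le_mul_of_nonneg_left (Real.log_le_log (div_pos hpa hpb) ?_) one_half_pos.le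
  rw [div_le_div_iff₀ hpb (sub_pos.2 hlt), mul_comm (1 + _)]
  exact hcenter

section KobayashiDist

variable {d e : ℕ} {Ω : Set (EuclideanSpace ℂ (Fin d))} {Ω' : Set (EuclideanSpace ℂ (Fin e))}
  {y z w : EuclideanSpace ℂ (Fin d)}

/-- `z` and `w` lie on a common analytic disc of `Ω`: the existence of a chain with one link. -/
def JoinedByDisc (Ω : Set (EuclideanSpace ℂ (Fin d))) (z w : EuclideanSpace ℂ (Fin d)) : Prop :=
  ∃ f, IsAnalyticDisc Ω f ∧ z ∈ f '' ball 0 1 ∧ w ∈ f '' ball 0 1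

theorem JoinedByDisc.symm (h : JoinedByDisc Ω z w) : JoinedByDisc Ω w z :=
  let ⟨f, hf, hz, hw⟩ := h
  ⟨f, hf, hw, hz⟩

theorem eventually_joinedByDisc (hopen : IsOpen Ω) (hz : z ∈ Ω) :
    ∀ᶠ w in 𝓝 z, JoinedByDisc Ω z w := by
  obtain ⟨r, hr, hball⟩ := Metric.isOpen_iff.1 hopen z hz
  filter_upwards [ball_mem_nhds z (half_pos hr)] with w hw
  refine ⟨fun ζ => z + (2 * ζ) • (w - z), ⟨by fun_prop, fun ζ hζ => hball ?_⟩,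
    ⟨0, by simp, by simp⟩, ⟨1 / 2, by rw [mem_ball_zero_iff]; norm_num, by simp⟩⟩
  rw [mem_ball_iff_norm] at hw ⊢
  rw [add_sub_cancel_left, norm_smul, norm_mul, Complex.norm_ofNat]
  calc 2 * ‖ζ‖ * ‖w - z‖ ≤ 2 * 1 * ‖w - z‖ := by
        gcongr
        exact (mem_ball_zero_iff.1 hζ).le
    _ < r := by linarith

theorem JoinedByDisc.chainLengths_nonempty (hzy : JoinedByDisc Ω z y)
    (hyw : (chainLengths Ω y w).Nonempty) : (chainLengths Ω z w).Nonempty := by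
  obtain ⟨g, hg, ⟨α, hα, rfl⟩, β, hβ, rfl⟩ := hzy
  obtain ⟨-, m, p, f, a, b, hp0, hpm, hlink, -⟩ := hyw
  refine ⟨_, m + 1, fun j => j.casesOn (g α) p, fun j => j.casesOn g f, fun j => j.casesOn α a,
    fun j => j.casesOn β b, rfl, hpm, fun j hj => ?_, rfl⟩
  cases j with
  | zero => exact ⟨hg, hα, hβ, rfl, hp0.symm⟩
  | succ j => exact hlink j (Nat.lt_of_succ_lt_succ hj)

theorem chainLengths_self_nonempty (z : EuclideanSpace ℂ (Fin d)) :
    (chainLengths Ω z z).Nonempty :=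
  ⟨0, 0, fun _ => z, fun _ _ => z, 0, 0, rfl, rfl, by simp, by simp⟩

theorem chainLengths_nonempty_of_reflTransGen (h : Relation.ReflTransGen (JoinedByDisc Ω) z w) :
    (chainLengths Ω z w).Nonempty := by
  induction h using Relation.ReflTransGen.head_induction_on with
  | refl => exact chainLengths_self_nonempty w
  | head hzy _ ih => exact hzy.chainLengths_nonempty ih

theorem chainLengths_nonempty (hopen : IsOpen Ω) (hconn : IsPreconnected Ω) (hz : z ∈ Ω)
    (hw : w ∈ Ω) : (chainLengths Ω z w).Nonempty := by
  refine chainLengths_nonempty_of_reflTransGen (hconn.induction₂'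
    (Relation.ReflTransGen (JoinedByDisc Ω)) (fun p hp => ?_)
    (fun _ _ _ _ _ _ h₁ h₂ => h₁.trans h₂) hz hw)
  filter_upwards [nhdsWithin_le_nhds (eventually_joinedByDisc hopen hp)] with q hq
  exact ⟨.single hq, .single hq.symm⟩

theorem bddBelow_chainLengths : BddBelow (chainLengths Ω z w) := by
  refine ⟨0, ?_⟩
  rintro L ⟨m, p, f, a, b, -, -, -, rfl⟩
  exact Finset.sum_nonneg fun j _ => poincareDist_nonneg _ _

theorem kobayashiDist_map_le {T : EuclideanSpace ℂ (Fin d) → EuclideanSpace ℂ (Fin e)}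
    (hT : DifferentiableOn ℂ T Ω) (hmaps : MapsTo T Ω Ω') (hne : (chainLengths Ω z w).Nonempty) :
    kobayashiDist Ω' (T z) (T w) ≤ kobayashiDist Ω z w := by
  refine csInf_le_csInf bddBelow_chainLengths hne ?_
  rintro L ⟨m, p, f, a, b, hp0, hpm, hlink, rfl⟩
  refine ⟨m, T ∘ p, fun j => T ∘ f j, a, b, congrArg T hp0, congrArg T hpm, fun j hj => ?_, rfl⟩
  obtain ⟨⟨hd, hmf⟩, ha, hb, hfa, hfb⟩ := hlink j hj
  exact ⟨⟨hT.comp hd hmf, hmaps.comp hmf⟩, ha, hb, congrArg T hfa, congrArg T hfb⟩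

theorem half_log_re_sub_le_kobayashiDist {F : EuclideanSpace ℂ (Fin d) → ℂ}
    (hF : DifferentiableOn ℂ F Ω) (hpos : ∀ p ∈ Ω, 0 < (F p).re)
    (hne : (chainLengths Ω z w).Nonempty) :
    1 / 2 * (Real.log (F z).re - Real.log (F w).re) ≤ kobayashiDist Ω z w := by
  refine le_csInf hne ?_
  rintro L ⟨m, p, f, a, b, rfl, rfl, hlink, rfl⟩
  rw [← Finset.sum_range_sub' (fun j => Real.log (F (p j)).re), Finset.mul_sum]
  refine Finset.sum_le_sum fun j hj => ?_
  obtain ⟨⟨hd, hmf⟩, ha, hb, hfa, hfb⟩ := hlink j (Finset.mem_range.1 hj)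
  rw [← hfa, ← hfb]
  exact half_log_re_sub_le_poincareDist (F := F ∘ f j) (hF.comp hd hmf)
    (fun ζ hζ => hpos _ (hmf hζ)) ha hb

end KobayashiDist

theorem homothety_mem {E : Type*} [AddCommGroup E] [Module ℝ E] [TopologicalSpace E]
    [IsTopologicalAddGroup E] [ContinuousConstSMul ℝ E] {s : Set E} (hopen : IsOpen s)
    (hconv : Convex ℝ s) {x z : E} (hx : x ∈ closure s) (hz : z ∈ s) {t : ℝ}
    (ht : t ∈ Ioc (0 : ℝ) 1) : homothety x t z ∈ s := by
  rw [homothety_apply, vadd_eq_add, add_comm, ← hopen.interior_eq]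
  exact hconv.add_smul_sub_mem_interior' hx (hopen.interior_eq.symm ▸ hz) ht

theorem tendsto_homothety_nhdsWithin {E : Type*} [AddCommGroup E] [Module ℝ E]
    [TopologicalSpace E] [IsTopologicalAddGroup E] [ContinuousSMul ℝ E] {s : Set E}
    (hopen : IsOpen s) (hconv : Convex ℝ s) {x z : E} (hx : x ∈ closure s) (hz : z ∈ s) :
    Tendsto (fun t : ℝ => homothety x t z) (𝓝[>] 0) (𝓝[s] x) := by
  refine tendsto_nhdsWithin_iff.2 ⟨?_, ?_⟩
  · have hcont : Continuous fun t : ℝ => homothety x t z := by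
      simp only [homothety_apply, vsub_eq_sub, vadd_eq_add]
      fun_prop
    simpa using (hcont.tendsto 0).mono_left nhdsWithin_le_nhds
  · filter_upwards [Ioc_mem_nhdsGT one_pos] with t ht
    exact homothety_mem hopen hconv hx hz ht

theorem frequently_add_le_succ_of_forall_mul_le {a : ℕ → ℝ} {c c' : ℝ} (hc : c' < c)
    (ha : ∀ n : ℕ, n * c ≤ a n) : ∃ᶠ n in atTop, a n + c' ≤ a (n + 1) := by
  intro hev
  obtain ⟨N, hN⟩ := eventually_atTop.1 hev
  have hupper : ∀ k : ℕ, a (N + k) ≤ a N + k * c' := fun k => by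
    induction k with
    | zero => simp
    | succ k ih =>
      have hstep := not_le.1 (hN (N + k) (Nat.le_add_right N k))
      rw [← add_assoc]
      push_cast
      linarith
  obtain ⟨k, hk⟩ := exists_nat_gt ((a N - N * c) / (c - c'))
  rw [div_lt_iff₀ (sub_pos.2 hc)] at hk
  have hlower := ha (N + k)
  push_cast at hlower
  linarith [hupper k]

section Convex

variable {d : ℕ} {Ω : Set (EuclideanSpace ℂ (Fin d))} {x z w o : EuclideanSpace ℂ (Fin d)} {t : ℝ}

theorem kobayashiDist_homothety_le (hopen : IsOpen Ω) (hconv : Convex ℝ Ω) (hx : x ∈ closure Ω)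
    (hz : z ∈ Ω) (hw : w ∈ Ω) (ht : t ∈ Ioc (0 : ℝ) 1) :
    kobayashiDist Ω (homothety x t z) (homothety x t w) ≤ kobayashiDist Ω z w := by
  have hdiff : Differentiable ℂ (homothety x t : EuclideanSpace ℂ (Fin d) → _) := by
    simp only [coe_homothety, vsub_eq_sub, vadd_eq_add]
    fun_prop
  exact kobayashiDist_map_le hdiff.differentiableOn (fun p hp => homothety_mem hopen hconv hx hp ht)
    (chainLengths_nonempty hopen hconv.isPreconnected hz hw)

theorem neg_half_log_le_kobayashiDist_homothety (hopen : IsOpen Ω) (hconv : Convex ℝ Ω)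
    (hx : x ∈ frontier Ω) (ho : o ∈ Ω) (ht : t ∈ Ioc (0 : ℝ) 1) :
    -(1 / 2 * Real.log t) ≤ kobayashiDist Ω o (homothety x t o) := by
  rw [hopen.frontier_eq] at hx
  obtain ⟨ℓ, hℓ⟩ := RCLike.geometric_hahn_banach_point_open (𝕜 := ℂ) hconv hopen hx.2
  have hpos : ∀ p ∈ Ω, 0 < (ℓ (p - x)).re := fun p hp => by
    rw [map_sub, Complex.sub_re]
    exact sub_pos.2 (hℓ p hp)
  have hscale : (ℓ (homothety x t o - x)).re = t * (ℓ (o - x)).re := by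
    rw [homothety_apply, vadd_eq_add, vsub_eq_sub, add_sub_cancel_right, ← Complex.coe_smul,
      map_smul, smul_eq_mul, Complex.re_ofReal_mul]
  calc -(1 / 2 * Real.log t)
      = 1 / 2 * (Real.log (ℓ (o - x)).re - Real.log (ℓ (homothety x t o - x)).re) := by
        rw [hscale, Real.log_mul ht.1.ne' (hpos o ho).ne']
        ring
    _ ≤ kobayashiDist Ω o (homothety x t o) :=
        half_log_re_sub_le_kobayashiDist (F := fun p => ℓ (p - x)) (by fun_prop) hpos
          (chainLengths_nonempty hopen hconv.isPreconnected ho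
            (homothety_mem hopen hconv hx.1 ho ht))

theorem liminf_kobayashiDist_homothety_sub_le (hopen : IsOpen Ω) (hconv : Convex ℝ Ω)
    (hx : x ∈ frontier Ω) (ho : o ∈ Ω) (ht : t ∈ Ioo (0 : ℝ) 1) :
    liminf (fun w => ((kobayashiDist Ω (homothety x t o) w - kobayashiDist Ω o w : ℝ) : EReal))
      (𝓝[Ω] x) ≤ ((1 / 2 * Real.log t : ℝ) : EReal) := by
  have hpow : ∀ n : ℕ, t ^ n ∈ Ioc (0 : ℝ) 1 := fun n =>
    ⟨pow_pos ht.1 n, pow_le_one₀ ht.1.le ht.2.le⟩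
  have hgrowth : ∀ n : ℕ,
      n * -(1 / 2 * Real.log t) ≤ kobayashiDist Ω o (homothety x (t ^ n) o) := fun n => by
    refine le_of_eq_of_le ?_ (neg_half_log_le_kobayashiDist_homothety hopen hconv hx ho (hpow n))
    rw [Real.log_pow]
    ring
  have hcontr : ∀ n : ℕ, kobayashiDist Ω (homothety x t o) (homothety x (t ^ (n + 1)) o) ≤
      kobayashiDist Ω o (homothety x (t ^ n) o) := fun n => by
    rw [pow_succ', homothety_mul_apply]
    exact kobayashiDist_homothety_le hopen hconv hx.1 ho
      (homothety_mem hopen hconv hx.1 ho (hpow n)) ⟨ht.1, ht.2.le⟩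
  have htend : Tendsto (fun n : ℕ => homothety x (t ^ (n + 1)) o) atTop (𝓝[Ω] x) :=
    ((tendsto_homothety_nhdsWithin hopen hconv hx.1 ho).comp
      (tendsto_pow_atTop_nhdsWithin_zero_of_lt_one ht.1 ht.2)).comp (tendsto_add_atTop_nat 1)
  refine EReal.le_of_forall_lt_iff_le.1 fun c hc => liminf_le_of_frequently_le' ?_
  have hfreq :=
    frequently_add_le_succ_of_forall_mul_le (neg_lt_neg (EReal.coe_lt_coe_iff.1 hc)) hgrowth
  refine htend.frequently (hfreq.mono fun n hn => EReal.coe_le_coe_iff.2 ?_)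
  linarith [hcontr n]

theorem homothety_mem_bigHorosphere (hopen : IsOpen Ω) (hconv : Convex ℝ Ω) (hx : x ∈ frontier Ω)
    (ho : o ∈ Ω) {R : ℝ} (ht : t ∈ Ioo (0 : ℝ) 1) (htR : t < R) :
    homothety x t o ∈ bigHorosphere Ω o x R := by
  have hlog : 1 / 2 * Real.log t < 1 / 2 * Real.log R :=
    mul_lt_mul_of_pos_left (Real.log_lt_log ht.1 htR) one_half_pos
  exact ⟨homothety_mem hopen hconv hx.1 ho ⟨ht.1, ht.2.le⟩,
    (liminf_kobayashiDist_homothety_sub_le hopen hconv hx ho ht).trans_lt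
      (EReal.coe_lt_coe_iff.2 hlog)⟩

end Convex

end Kobayashi

theorem proposition3p5_general {d : ℕ} (Ω : Set (EuclideanSpace ℂ (Fin d)))
    (hΩ_open : IsOpen Ω) (hΩ_convex : Convex ℝ Ω)
    (x : EuclideanSpace ℂ (Fin d)) (hx : x ∈ frontier Ω)
    (R : ℝ) (hR : 0 < R) (o : EuclideanSpace ℂ (Fin d)) (ho : o ∈ Ω) :
    x ∈ closure (Kobayashi.bigHorosphere Ω o x R) := by
  have htend : Tendsto (fun t : ℝ => AffineMap.homothety x t o) (𝓝[>] 0) (𝓝 x) :=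
    (Kobayashi.tendsto_homothety_nhdsWithin hΩ_open hΩ_convex hx.1 ho).mono_right
      nhdsWithin_le_nhds
  refine mem_closure_of_tendsto htend ?_
  filter_upwards [Ioo_mem_nhdsGT one_pos, Ioo_mem_nhdsGT hR] with t ht htR
  exact Kobayashi.homothety_mem_bigHorosphere hΩ_open hΩ_convex hx ho ht htR.2

theorem proposition3p5 {d : ℕ} (Ω : Set (EuclideanSpace ℂ (Fin d)))
    (hΩ_open : IsOpen Ω) (hΩ_convex : Convex ℝ Ω) (hΩ_hyp : Kobayashi.IsHyperbolic Ω)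
    (x : EuclideanSpace ℂ (Fin d)) (hx : x ∈ frontier Ω)
    (R : ℝ) (hR : 0 < R) (o : EuclideanSpace ℂ (Fin d)) (ho : o ∈ Ω) :
    x ∈ closure (Kobayashi.bigHorosphere Ω o x R) :=
  proposition3p5_general Ω hΩ_open hΩ_convex x hx R hR o ho
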